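/- Let $n\ge 0$ be an integer and let $K\subset\mathbb{R}^n$ be a convex body, i.e., a non-empty compact convex set (not necessarily with interior points). For a convex body $L\subset\mathbb{R}^n$ let the quermassintegrals $W_0(L),\dots,W_n(L)$ be the coefficients in the Steiner formula $$\mathrm{vol}(L+tB_2^n)=\sum_{i=0}^n\binom{n}{i}W_i(L)\,t^i\qquad\text{for all } t\ge 0,$$ where $B_2^n$ is the closed Euclidean unit ball of $\mathbb{R}^n$; let $V_i(L)=\binom{n}{i}W_{n-i}(L)/\kappa_{n-i}$, with $\kappa_j$ the volume of the unit ball of $\mathbb{R}^j$, be the intrinsic volumes of $L$, and let $\mathcal{W}(L)=\sum_{i=0}^nV_i(L)$ be its Wills functional. Then the difference body $K-K=\{x-y:x,y\in K\}$ satisfies $$\mathcal{W}(K-K)\le\frac{\binom{2n}{n}}{2^{n/2}}\,\mathcal{W}\bigl(\sqrt{2}\,K\bigr).$$ -/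

import Mathlib

open MeasureTheory
open scoped Pointwise

/-- `κ_k`, the `k`-dimensional volume of the Euclidean unit ball of `ℝ^k`. -/
noncomputable def unitBallVolume (k : ℕ) : ℝ :=
  volume.real (Metric.closedBall (0 : EuclideanSpace ℝ (Fin k)) 1)

/-- `W = (W_0, …, W_n)` are the coefficients in the Steiner formula of `K`:
`vol (K + t B) = ∑ i, binom(n,i) W_i t^i` for all `t ≥ 0`, with `B` the Euclidean unit ball. -/
def IsSteinerCoeff {n : ℕ} (K : ConvexBody (EuclideanSpace ℝ (Fin n)))
    (W : Fin (n + 1) → ℝ) : Prop :=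
  ∀ t : ℝ, 0 ≤ t →
    volume.real ((K : Set (EuclideanSpace ℝ (Fin n))) +
        t • Metric.closedBall (0 : EuclideanSpace ℝ (Fin n)) 1) =
      ∑ i : Fin (n + 1), (n.choose i : ℝ) * W i * t ^ (i : ℕ)

/-- There is at most one family of coefficients in the Steiner formula. -/
theorem IsSteinerCoeff.unique {n : ℕ} {K : ConvexBody (EuclideanSpace ℝ (Fin n))}
    {W W' : Fin (n + 1) → ℝ} (h : IsSteinerCoeff K W) (h' : IsSteinerCoeff K W') : W = W' := by
  let p : (Fin (n + 1) → ℝ) → Polynomial ℝ := fun V =>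
    ∑ i : Fin (n + 1), Polynomial.monomial (i : ℕ) ((n.choose i : ℝ) * V i)
  have hp : ∀ V t, (p V).eval t = ∑ i : Fin (n + 1), (n.choose i : ℝ) * V i * t ^ (i : ℕ) := by
    intro V t
    simp [p, Polynomial.eval_finsetSum]
  have hpp : p W = p W' := by
    refine Polynomial.eq_of_infinite_eval_eq _ _ ((Set.Ici_infinite (0 : ℝ)).mono ?_)
    intro t ht
    rw [Set.mem_ofPred_eq, hp, hp, ← h t ht, ← h' t ht]
  have hc : ∀ V (i : Fin (n + 1)), (p V).coeff i = (n.choose i : ℝ) * V i := by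
    intro V i
    simp [p, Polynomial.finsetSum_coeff, Polynomial.coeff_monomial, Fin.val_inj]
  funext i
  have hi := hc W i
  rw [hpp, hc W' i] at hi
  have hne : (n.choose i : ℝ) ≠ 0 := by
    exact_mod_cast (Nat.choose_pos (Nat.lt_succ_iff.mp i.isLt)).ne'
  exact (mul_left_cancel₀ hne hi).symm

open Classical in
/-- The quermassintegrals `W_0(K), …, W_n(K)`: the coefficients in the Steiner formula of `K`. -/
noncomputable def quermassintegral {n : ℕ} (K : ConvexBody (EuclideanSpace ℝ (Fin n))) :
    Fin (n + 1) → ℝ :=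
  if h : ∃ W : Fin (n + 1) → ℝ, IsSteinerCoeff K W then h.choose else 0

theorem IsSteinerCoeff.quermassintegral_eq {n : ℕ} {K : ConvexBody (EuclideanSpace ℝ (Fin n))}
    {W : Fin (n + 1) → ℝ} (h : IsSteinerCoeff K W) : quermassintegral K = W := by
  have hex : ∃ W : Fin (n + 1) → ℝ, IsSteinerCoeff K W := ⟨W, h⟩
  rw [quermassintegral, dif_pos hex]
  exact hex.choose_spec.unique h

/-- The intrinsic volumes `V_i(K) = binom(n,i) / κ_{n-i} * W_{n-i}(K)` (`i.rev` is `n - i`). -/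
noncomputable def intrinsicVolume {n : ℕ} (K : ConvexBody (EuclideanSpace ℝ (Fin n)))
    (i : Fin (n + 1)) : ℝ :=
  (n.choose i : ℝ) / unitBallVolume (n - i) * quermassintegral K i.rev

/-- The Wills functional: the sum of the intrinsic volumes. -/
noncomputable def willsFunctional {n : ℕ} (K : ConvexBody (EuclideanSpace ℝ (Fin n))) : ℝ :=
  ∑ i : Fin (n + 1), intrinsicVolume K i

/-- The difference body `K - K = K + (-K)`. -/
noncomputable def differenceBody {n : ℕ} (K : ConvexBody (EuclideanSpace ℝ (Fin n))) :
    ConvexBody (EuclideanSpace ℝ (Fin n)) :=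
  K + (-1 : ℝ) • K

/-! With `willsWeight t` = 2πt exp(-πt²), the j-th moment over t > 0 is 1/κ_j, so the Steiner
formula turns the Wills functional into the integral of `willsWeight t` · vol(K + tB). It then
suffices to compare parallel volumes at each t > 0. Since B = -B, (K - K) + tB = L - L with L = K +
(t/2)B. The Rogers–Shephard inequality bounds its volume by binom(2n,n) vol(L), and vol(L) ≤ vol(K +
(t/√2)B) = 2^(-n/2) vol(√2 K + tB). Two classical inputs are proved on the way: the Steiner formula
(`exists_polynomial_measureReal_add_closedBall`), by cutting parallel bodies of polytopes into cells
and approximating; and Rogers–Shephard (`measureReal_sub_self_le`), by two applications of Tonelli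
and a beta integral. -/

/-! ### Nearest point map of a convex set -/

section NearestPoint

variable {E : Type*} [NormedAddCommGroup E] [InnerProductSpace ℝ E]

theorem eq_of_inner_sub_nonpos {K : Set E} {x p q : E} (hp : p ∈ K) (hq : q ∈ K)
    (h : ∀ w ∈ K, inner ℝ (x - p) (w - p) ≤ 0) (h' : ∀ w ∈ K, inner ℝ (x - q) (w - q) ≤ 0) :
    p = q := by
  have h1 := h q hq
  have h2 := h' p hp
  have h3 : inner ℝ (p - q) (p - q) = inner ℝ (x - p) (q - p) + inner ℝ (x - q) (p - q) := by
    simp only [inner_sub_left, inner_sub_right, real_inner_comm]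
    ring
  have h4 : inner ℝ (p - q) (p - q) ≤ 0 := by linarith
  rwa [real_inner_self_eq_norm_sq, sq_nonpos_iff, norm_eq_zero, sub_eq_zero] at h4

/-- Testing each variational inequality at the other point and adding gives ‖p - q‖² ≤ ⟪x - y, p -
q⟫; Cauchy–Schwarz finishes. -/
theorem norm_sub_le_of_inner_sub_nonpos {K : Set E} {x y p q : E} (hp : p ∈ K) (hq : q ∈ K)
    (h : ∀ w ∈ K, inner ℝ (x - p) (w - p) ≤ 0) (h' : ∀ w ∈ K, inner ℝ (y - q) (w - q) ≤ 0) :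
    ‖p - q‖ ≤ ‖x - y‖ := by
  have h1 := h q hq
  have h2 := h' p hp
  have h3 : inner ℝ (p - q) (p - q) - inner ℝ (x - y) (p - q) =
      inner ℝ (x - p) (q - p) + inner ℝ (y - q) (p - q) := by
    simp only [inner_sub_left, inner_sub_right, real_inner_comm]
    ring
  have h4 := real_inner_le_norm (x - y) (p - q)
  rw [real_inner_self_eq_norm_sq] at h3
  by_contra! hc
  nlinarith [norm_nonneg (x - y), norm_nonneg (p - q)]

theorem norm_sub_le_norm_sub_of_inner_sub_nonpos {K : Set E} {x p y : E}
    (h : ∀ w ∈ K, inner ℝ (x - p) (w - p) ≤ 0) (hy : y ∈ K) : ‖x - p‖ ≤ ‖x - y‖ := by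
  have h1 := h y hy
  have h3 : inner ℝ (x - p) (x - p) - inner ℝ (x - p) (x - y) =
      inner ℝ (x - p) (y - p) := by
    rw [← inner_sub_right]
    congr 1
    abel
  have h4 := real_inner_le_norm (x - p) (x - y)
  rw [real_inner_self_eq_norm_sq] at h3
  by_contra! hc
  nlinarith [norm_nonneg (x - y), norm_nonneg (x - p)]

/-- The nearest point map of a complete convex set. -/
theorem exists_continuous_nearestPoint {K : Set E} (hne : K.Nonempty) (hK : IsComplete K)
    (hc : Convex ℝ K) :
    ∃ p : E → E, Continuous p ∧ ∀ x, p x ∈ K ∧ ∀ w ∈ K, inner ℝ (x - p x) (w - p x) ≤ 0 := by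
  have h : ∀ x, ∃ q ∈ K, ∀ w ∈ K, inner ℝ (x - q) (w - q) ≤ 0 := by
    intro x
    obtain ⟨q, hq, hx⟩ := exists_norm_eq_iInf_of_complete_convex hne hK hc x
    exact ⟨q, hq, (norm_eq_iInf_iff_real_inner_le_zero hc hq).1 hx⟩
  choose p hp hp' using h
  refine ⟨p, (LipschitzWith.of_dist_le_mul (K := 1) fun x y => ?_).continuous,
    fun x => ⟨hp x, hp' x⟩⟩
  rw [NNReal.coe_one, one_mul, dist_eq_norm, dist_eq_norm]
  exact norm_sub_le_of_inner_sub_nonpos (hp x) (hp y) (hp' x) (hp' y)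

end NearestPoint

/-! ### Decomposition of the parallel body of a polytope by exposed faces -/

section PolytopeCells

variable {E : Type*} [NormedAddCommGroup E] [InnerProductSpace ℝ E]

/-- The vectors `u` for which the functional `⟪u, ·⟫` attains its maximum over `S` exactly
at the points of `T`. -/
def exposingCone (S T : Set E) : Set E :=
  {u | ∀ a ∈ S, a ∈ T ↔ ∀ b ∈ S, inner ℝ u b ≤ inner ℝ u a}

theorem smul_mem_exposingCone {S T : Set E} {u : E} (hu : u ∈ exposingCone S T) {s : ℝ}
    (hs : 0 < s) : s • u ∈ exposingCone S T := by
  intro a ha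
  rw [hu a ha]
  simp only [real_inner_smul_left, mul_le_mul_iff_right₀ hs]

theorem inner_eq_of_mem_exposingCone {S T : Set E} (hT : T ⊆ S) {u a b : E}
    (hu : u ∈ exposingCone S T) (ha : a ∈ T) (hb : b ∈ T) : inner ℝ u a = inner ℝ u b :=
  le_antisymm ((hu b (hT hb)).1 hb a (hT ha)) ((hu a (hT ha)).1 ha b (hT hb))

theorem exposingCone_subset_orthogonal {S T : Set E} (hT : T ⊆ S) {u : E}
    (hu : u ∈ exposingCone S T) : u ∈ (vectorSpan ℝ T)ᗮ := by
  rw [Submodule.mem_orthogonal']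
  intro v hv
  refine Submodule.span_induction (p := fun v _ => inner ℝ u v = 0) ?_ (by simp) ?_ ?_ hv
  · rintro _ ⟨a, ha, b, hb, rfl⟩
    change inner ℝ u (a - b) = 0
    rw [inner_sub_right, inner_eq_of_mem_exposingCone hT hu ha hb, sub_self]
  · intro x y _ _ hx hy
    rw [inner_add_right, hx, hy, add_zero]
  · intro c x _ hx
    rw [real_inner_smul_right, hx, mul_zero]

theorem inner_sub_nonpos_of_mem_exposingCone {S T : Set E} (hT : T ⊆ S) {u y w : E}
    (hu : u ∈ exposingCone S T) (hy : y ∈ convexHull ℝ T) (hw : w ∈ convexHull ℝ S) :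
    inner ℝ u (w - y) ≤ 0 := by
  rw [inner_sub_right, sub_nonpos]
  have hlin : IsLinearMap ℝ fun x : E => (inner ℝ u x : ℝ) :=
    ⟨fun x y => inner_add_right u x y, fun c x => by rw [real_inner_smul_right, smul_eq_mul]⟩
  have hTne : T.Nonempty := convexHull_nonempty_iff.1 ⟨y, hy⟩
  obtain ⟨a, ha⟩ := hTne
  have h1 : w ∈ {x : E | inner ℝ u x ≤ inner ℝ u a} :=
    convexHull_min (fun b hb => (hu a (hT ha)).1 ha b hb) (convex_halfSpace_le hlin _) hw
  have h2 : y ∈ {x : E | inner ℝ u a ≤ inner ℝ u x} :=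
    convexHull_min (fun b hb => (inner_eq_of_mem_exposingCone hT hu ha hb).le)
      (convex_halfSpace_ge hlin _) hy
  exact le_trans h1 h2

/-- A convex combination that maximizes a linear functional puts weight only on maximizing points.
-/
theorem mem_convexHull_of_forall_inner_le {S : Finset E} {T : Set E} {u x : E}
    (hu : u ∈ exposingCone (S : Set E) T) (hx : x ∈ convexHull ℝ (S : Set E))
    (hmax : ∀ b ∈ S, inner ℝ u b ≤ inner ℝ u x) : x ∈ convexHull ℝ (T ∩ S) := by
  obtain ⟨w, hw0, hw1, rfl⟩ := Finset.mem_convexHull'.1 hx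
  have hsum : ∑ a ∈ S, w a * (inner ℝ u (∑ y ∈ S, w y • y) - inner ℝ u a) = 0 := by
    simp only [mul_sub, Finset.sum_sub_distrib, ← Finset.sum_mul, hw1, one_mul]
    rw [inner_sum]
    simp only [real_inner_smul_right, sub_self]
  have hz := (Finset.sum_eq_zero_iff_of_nonneg fun a ha =>
    mul_nonneg (hw0 a ha) (sub_nonneg.2 (hmax a ha))).1 hsum
  have hmem : ∀ a ∈ S, w a ≠ 0 → a ∈ T := by
    intro a ha hne
    have h := (mul_eq_zero.1 (hz a ha)).resolve_left hne
    rw [hu a ha]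
    intro b hb
    linarith [hmax b hb]
  classical
  rw [← Finset.sum_filter_of_ne (p := fun a => a ∈ T)
    (fun a ha hne => hmem a ha fun h0 => hne (by rw [h0, zero_smul]))]
  refine (convex_convexHull ℝ _).sum_mem (fun a ha => hw0 a (Finset.mem_filter.1 ha).1) ?_
    (fun a ha => subset_convexHull ℝ _ ⟨(Finset.mem_filter.1 ha).2, (Finset.mem_filter.1 ha).1⟩)
  rw [Finset.sum_filter_of_ne (p := fun a => a ∈ T) hmem, hw1]

/-- The points of `conv T + t B` whose outer normal vector exposes exactly `T`. -/
def polytopeCell (S T : Set E) (t : ℝ) : Set E :=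
  convexHull ℝ T + (exposingCone S T ∩ Metric.closedBall 0 t)

theorem nearestPoint_eq_of_mem_polytopeCell {S T : Set E} (hT : T ⊆ S) {p : E → E}
    (hp : ∀ x, p x ∈ convexHull ℝ S ∧ ∀ w ∈ convexHull ℝ S, inner ℝ (x - p x) (w - p x) ≤ 0)
    {y u : E} (hy : y ∈ convexHull ℝ T) (hu : u ∈ exposingCone S T) : p (y + u) = y := by
  refine eq_of_inner_sub_nonpos (hp _).1 (convexHull_mono hT hy) (hp _).2 fun w hw => ?_
  rw [add_sub_cancel_left]
  exact inner_sub_nonpos_of_mem_exposingCone hT hu hy hw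

/-- Describes cells through the residual x - p x alone; covering, disjointness and measurability of
the cells are read off from this. -/
theorem mem_polytopeCell_iff {S : Finset E} {T : Set E} (hT : T ⊆ S) {p : E → E}
    (hp : ∀ x, p x ∈ convexHull ℝ (S : Set E) ∧
      ∀ w ∈ convexHull ℝ (S : Set E), inner ℝ (x - p x) (w - p x) ≤ 0) {t : ℝ} {x : E} :
    x ∈ polytopeCell (S : Set E) T t ↔
      x - p x ∈ exposingCone (S : Set E) T ∧ ‖x - p x‖ ≤ t := by
  constructor
  · rintro ⟨y, hy, u, ⟨hu, hut⟩, rfl⟩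
    simp only [nearestPoint_eq_of_mem_polytopeCell hT hp hy hu, add_sub_cancel_left]
    exact ⟨hu, mem_closedBall_zero_iff.1 hut⟩
  · rintro ⟨h1, h2⟩
    refine ⟨p x, ?_, x - p x, ⟨h1, mem_closedBall_zero_iff.2 h2⟩, add_sub_cancel _ _⟩
    have h := mem_convexHull_of_forall_inner_le h1 (hp x).1 fun b hb => by
      have := (hp x).2 b (subset_convexHull ℝ _ hb)
      rw [inner_sub_right] at this
      linarith
    exact convexHull_mono Set.inter_subset_left h

theorem convexHull_add_closedBall_eq_iUnion {S : Finset E} {p : E → E}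
    (hp : ∀ x, p x ∈ convexHull ℝ (S : Set E) ∧
      ∀ w ∈ convexHull ℝ (S : Set E), inner ℝ (x - p x) (w - p x) ≤ 0) (t : ℝ) :
    convexHull ℝ (S : Set E) + Metric.closedBall 0 t =
      ⋃ T ∈ S.powerset, polytopeCell (S : Set E) (T : Set E) t := by
  classical
  ext x
  simp only [Set.mem_iUnion, exists_prop, Finset.mem_powerset]
  constructor
  · rintro ⟨y, hy, b, hb, rfl⟩
    obtain ⟨x, hx⟩ : ∃ x, x = y + b := ⟨_, rfl⟩
    rw [show (fun x1 x2 : E => x1 + x2) y b = x from hx.symm]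
    -- The cell containing x is indexed by the points of S that maximize the residual functional.
    refine ⟨S.filter fun a => ∀ b ∈ S, inner ℝ (x - p x) b ≤ inner ℝ (x - p x) a,
      Finset.filter_subset _ _, ?_⟩
    rw [mem_polytopeCell_iff (Finset.coe_subset.2 (Finset.filter_subset _ _)) hp]
    refine ⟨fun a ha => ?_, ?_⟩
    · have ha' : a ∈ S := ha
      simp [ha']
    · refine (norm_sub_le_norm_sub_of_inner_sub_nonpos (hp x).2 hy).trans ?_
      simpa [hx] using hb
  · rintro ⟨T, hT, y, hy, u, hu, rfl⟩
    exact ⟨y, convexHull_mono (Finset.coe_subset.2 hT) hy, u, hu.2, rfl⟩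

theorem pairwiseDisjoint_polytopeCell {S : Finset E} {p : E → E}
    (hp : ∀ x, p x ∈ convexHull ℝ (S : Set E) ∧
      ∀ w ∈ convexHull ℝ (S : Set E), inner ℝ (x - p x) (w - p x) ≤ 0) (t : ℝ) :
    (S.powerset : Set (Finset E)).PairwiseDisjoint
      fun T => polytopeCell (S : Set E) (T : Set E) t := by
  intro T hT T' hT' hne
  rw [Function.onFun, Set.disjoint_left]
  intro x hx hx'
  simp only [Finset.coe_powerset, Set.mem_preimage, Set.mem_powerset_iff] at hT hT'
  rw [mem_polytopeCell_iff hT hp] at hx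
  rw [mem_polytopeCell_iff hT' hp] at hx'
  apply hne
  ext a
  constructor
  · intro ha
    exact (hx'.1 a (hT ha)).2 ((hx.1 a (hT ha)).1 ha)
  · intro ha
    exact (hx.1 a (hT' ha)).2 ((hx'.1 a (hT' ha)).1 ha)

theorem measurableSet_polytopeCell [MeasurableSpace E] [BorelSpace E] {S T : Finset E}
    (hT : T ⊆ S) {p : E → E} (hpc : Continuous p)
    (hp : ∀ x, p x ∈ convexHull ℝ (S : Set E) ∧
      ∀ w ∈ convexHull ℝ (S : Set E), inner ℝ (x - p x) (w - p x) ≤ 0) (t : ℝ) :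
    MeasurableSet (polytopeCell (S : Set E) (T : Set E) t) := by
  have hcont : Continuous fun x => x - p x := continuous_id.sub hpc
  have hset : polytopeCell (S : Set E) (T : Set E) t =
      (⋂ a ∈ (S : Set E), {x | a ∈ T ↔ ∀ b ∈ S, inner ℝ (x - p x) b ≤ inner ℝ (x - p x) a}) ∩
        {x | ‖x - p x‖ ≤ t} := by
    ext x
    rw [mem_polytopeCell_iff (Finset.coe_subset.2 hT) hp]
    simp [exposingCone]
  rw [hset]
  refine (MeasurableSet.biInter S.countable_toSet fun a _ => ?_).inter
    (isClosed_le hcont.norm continuous_const).measurableSet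
  have hA : MeasurableSet {x | ∀ b ∈ S, inner ℝ (x - p x) b ≤ inner ℝ (x - p x) a} := by
    have : {x | ∀ b ∈ S, inner ℝ (x - p x) b ≤ inner ℝ (x - p x) a} =
        ⋂ b ∈ (S : Set E), {x | inner ℝ (x - p x) b ≤ inner ℝ (x - p x) a} := by
      ext x
      simp
    rw [this]
    exact MeasurableSet.biInter S.countable_toSet fun b _ =>
      (isClosed_le (hcont.inner continuous_const) (hcont.inner continuous_const)).measurableSet
  by_cases ha : a ∈ T
  · simpa [ha] using hA
  · simp only [ha, false_iff]
    exact hA.compl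

end PolytopeCells

/-! ### The Steiner formula -/

section Steiner

variable {E : Type*} [NormedAddCommGroup E] [InnerProductSpace ℝ E] [FiniteDimensional ℝ E]

/-- The map which is the identity on `V` and the homothety of ratio `s` on `Vᗮ`. -/
noncomputable def orthogonalStretch (V : Submodule ℝ E) (s : ℝ) : E →ₗ[ℝ] E :=
  s • LinearMap.id + (1 - s) • V.starProjection.toLinearMap

theorem orthogonalStretch_add_apply {V : Submodule ℝ E} (s : ℝ) {v u : E} (hv : v ∈ V)
    (hu : u ∈ Vᗮ) : orthogonalStretch V s (v + u) = v + s • u := by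
  have h1 : V.starProjection v = v := Submodule.starProjection_eq_self_iff.2 hv
  have h2 : V.starProjection u = 0 := (Submodule.starProjection_apply_eq_zero_iff V).2 hu
  simp only [orthogonalStretch, LinearMap.add_apply, LinearMap.smul_apply, LinearMap.id_apply,
    ContinuousLinearMap.coe_coe, map_add, h1, h2]
  module

/-- The map is block triangular: the identity on V and multiplication by s on E ⧸ V. -/
theorem det_orthogonalStretch (V : Submodule ℝ E) (s : ℝ) :
    (orthogonalStretch V s).det = s ^ Module.finrank ℝ (E ⧸ V) := by
  have hV : ∀ v ∈ V, orthogonalStretch V s v = v := fun v hv => by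
    simpa using orthogonalStretch_add_apply s hv (Vᗮ.zero_mem)
  have he : V ≤ V.comap (orthogonalStretch V s) := fun v hv => by
    rw [Submodule.mem_comap, hV v hv]
    exact hv
  have h1 : (orthogonalStretch V s).restrict he = LinearMap.id := by
    ext v
    simp [hV]
  have h2 : V.mapQ V (orthogonalStretch V s) he = s • LinearMap.id := by
    ext x
    simp only [orthogonalStretch, LinearMap.comp_apply, Submodule.mkQ_apply,
      Submodule.mapQ_apply, LinearMap.add_apply, LinearMap.smul_apply, LinearMap.id_apply,
      Submodule.Quotient.mk_add, Submodule.Quotient.mk_smul, ContinuousLinearMap.coe_coe]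
    rw [(Submodule.Quotient.mk_eq_zero V).2 (Submodule.starProjection_apply_mem V x), smul_zero,
      add_zero]
  rw [LinearMap.det_eq_det_mul_det V _ he, h1, h2, LinearMap.det_smul]
  simp

/-- The exposing cone is invariant under positive scaling and orthogonal to the directions of conv
T, so stretching the normal part by s carries radius 1 to radius s. -/
theorem polytopeCell_eq_vadd_image {S T : Set E} (hT : T ⊆ S) {a : E} (ha : a ∈ T) {s : ℝ}
    (hs : 0 < s) :
    polytopeCell S T s =
      a +ᵥ (orthogonalStretch (vectorSpan ℝ T) s '' (-a +ᵥ polytopeCell S T 1)) := by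
  have key : ∀ y ∈ convexHull ℝ T, ∀ u ∈ exposingCone S T,
      a +ᵥ orthogonalStretch (vectorSpan ℝ T) s (-a +ᵥ (y + u)) = y + s • u := by
    intro y hy u hu
    have hya : y - a ∈ vectorSpan ℝ T := by
      rw [← direction_affineSpan]
      exact AffineSubspace.vsub_mem_direction (convexHull_subset_affineSpan T hy)
        (subset_affineSpan ℝ T ha)
    have h := orthogonalStretch_add_apply s hya (exposingCone_subset_orthogonal hT hu)
    rw [vadd_eq_add, vadd_eq_add, show -a + (y + u) = y - a + u by abel, h]
    abel
  ext x
  constructor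
  · rintro ⟨y, hy, v, ⟨hv, hvs⟩, rfl⟩
    have hv' := smul_mem_exposingCone hv (inv_pos.2 hs)
    refine ⟨_, ⟨_, ⟨y + s⁻¹ • v, ⟨y, hy, s⁻¹ • v, ⟨hv', ?_⟩, rfl⟩, rfl⟩, rfl⟩, ?_⟩
    · rw [mem_closedBall_zero_iff] at hvs ⊢
      rw [norm_smul, norm_inv, Real.norm_of_nonneg hs.le]
      exact inv_mul_le_one_of_le₀ hvs hs.le
    · refine (key y hy _ hv').trans ?_
      rw [smul_inv_smul₀ hs.ne']
  · rintro ⟨_, ⟨_, ⟨_, ⟨y, hy, v, ⟨hv, hvs⟩, rfl⟩, rfl⟩, rfl⟩, rfl⟩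
    refine ⟨y, hy, s • v, ⟨smul_mem_exposingCone hv hs, ?_⟩, (key y hy v hv).symm⟩
    rw [mem_closedBall_zero_iff] at hvs ⊢
    rw [norm_smul, Real.norm_of_nonneg hs.le]
    exact mul_le_of_le_one_right hs.le hvs

variable [MeasurableSpace E] [BorelSpace E] (μ : Measure E) [μ.IsAddHaarMeasure]

theorem measureReal_polytopeCell {S T : Set E} (hT : T ⊆ S) {s : ℝ} (hs : 0 < s) :
    μ.real (polytopeCell S T s) =
      μ.real (polytopeCell S T 1) * s ^ Module.finrank ℝ (E ⧸ vectorSpan ℝ T) := by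
  rcases T.eq_empty_or_nonempty with rfl | ⟨a, ha⟩
  · simp [polytopeCell]
  rw [polytopeCell_eq_vadd_image hT ha hs, measureReal_def, measure_vadd,
    Measure.addHaar_image_linearMap, measure_vadd, det_orthogonalStretch, ENNReal.toReal_mul,
    ENNReal.toReal_ofReal (abs_nonneg _), abs_of_nonneg (by positivity), mul_comm, measureReal_def]

theorem exists_polynomial_measureReal_convexHull_add_closedBall {S : Finset E}
    (hS : S.Nonempty) :
    ∃ q : Polynomial ℝ, q.natDegree ≤ Module.finrank ℝ E ∧ ∀ t : ℝ, 0 < t →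
      μ.real (convexHull ℝ (S : Set E) + Metric.closedBall 0 t) = q.eval t := by
  have hcpt : IsCompact (convexHull ℝ (S : Set E)) := S.finite_toSet.isCompact_convexHull ℝ
  obtain ⟨p, hpc, hp⟩ := exists_continuous_nearestPoint
    ((Finset.coe_nonempty.2 hS).convexHull (𝕜 := ℝ)) hcpt.isComplete (convex_convexHull ℝ _)
  refine ⟨∑ T ∈ S.powerset, Polynomial.C (μ.real (polytopeCell (S : Set E) (T : Set E) 1)) *
    Polynomial.X ^ Module.finrank ℝ (E ⧸ vectorSpan ℝ (T : Set E)),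
    Polynomial.natDegree_sum_le_of_forall_le _ _ fun T _ =>
      (Polynomial.natDegree_C_mul_X_pow_le _ _).trans (Submodule.finrank_quotient_le _),
    fun t ht => ?_⟩
  rw [convexHull_add_closedBall_eq_iUnion hp, measureReal_biUnion_finset
    (pairwiseDisjoint_polytopeCell hp t)
    (fun T hT => measurableSet_polytopeCell (Finset.mem_powerset.1 hT) hpc hp t) fun T hT => ?_,
    Polynomial.eval_finsetSum]
  rotate_left
  · refine ((measure_mono ?_).trans_lt
      (hcpt.add (isCompact_closedBall (0 : E) t)).measure_lt_top).ne
    rw [convexHull_add_closedBall_eq_iUnion hp]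
    exact Set.subset_biUnion_of_mem (u := fun T : Finset E =>
      polytopeCell (S : Set E) (T : Set E) t) hT
  · refine Finset.sum_congr rfl fun T hT => ?_
    rw [measureReal_polytopeCell μ (Finset.coe_subset.2 (Finset.mem_powerset.1 hT)) ht]
    simp

/-- For a finite ε-net S of K in K, K + tB ⊆ conv S + (ε + t)B ⊆ K + (ε + t)B. -/
theorem exists_polynomial_between {K : Set E} (hK : IsCompact K) (hc : Convex ℝ K)
    (hne : K.Nonempty) {ε : ℝ} (hε : 0 < ε) :
    ∃ q : Polynomial ℝ, q.natDegree ≤ Module.finrank ℝ E ∧ ∀ t : ℝ, 0 ≤ t →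
      μ.real (K + Metric.closedBall 0 t) ≤ q.eval t ∧
        q.eval t ≤ μ.real (K + Metric.closedBall 0 (ε + t)) := by
  obtain ⟨S, hSK, hSf, hcov⟩ := hK.finite_cover_balls hε
  lift S to Finset E using hSf
  have hSne : S.Nonempty := by
    rw [Finset.nonempty_iff_ne_empty]
    rintro rfl
    obtain ⟨x, hx⟩ := hne
    simpa using hcov hx
  obtain ⟨q, hq, hqe⟩ := exists_polynomial_measureReal_convexHull_add_closedBall μ hSne
  have hcpt : IsCompact (convexHull ℝ (S : Set E)) := S.finite_toSet.isCompact_convexHull ℝ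
  -- The shift by ε keeps the argument positive even at t = 0, where the polytope formula is not
  -- available.
  refine ⟨q.comp (Polynomial.X + Polynomial.C ε), ?_, fun t ht => ?_⟩
  · refine Polynomial.natDegree_comp_le.trans ?_
    rw [Polynomial.natDegree_X_add_C, mul_one]
    exact hq
  rw [Polynomial.eval_comp, Polynomial.eval_add, Polynomial.eval_X, Polynomial.eval_C,
    add_comm t, ← hqe _ (by positivity)]
  constructor
  · refine measureReal_mono ?_ (hcpt.add (isCompact_closedBall 0 _)).measure_lt_top.ne
    have hB : Metric.closedBall (0 : E) (ε + t) =
        Metric.closedBall 0 ε + Metric.closedBall 0 t := by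
      rw [closedBall_add_closedBall hε.le ht, add_zero]
    rw [hB, ← add_assoc]
    refine Set.add_subset_add_right fun x hx => ?_
    obtain ⟨a, ha, hxa⟩ := Set.mem_iUnion₂.1 (hcov hx)
    refine ⟨a, subset_convexHull ℝ _ ha, x - a, ?_, add_sub_cancel _ _⟩
    rw [mem_closedBall_zero_iff, ← dist_eq_norm]
    exact (Metric.mem_ball.1 hxa).le
  · exact measureReal_mono (Set.add_subset_add_right (convexHull_min hSK hc))
      (hK.add (isCompact_closedBall 0 _)).measure_lt_top.ne

theorem tendsto_measureReal_add_closedBall {K : Set E} (hK : IsCompact K) {t : ℝ} (ht : 0 ≤ t) :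
    Filter.Tendsto (fun m : ℕ => μ.real (K + Metric.closedBall 0 (1 / ((m : ℝ) + 1) + t)))
      Filter.atTop (nhds (μ.real (K + Metric.closedBall 0 t))) := by
  have hcpt : IsCompact (K + Metric.closedBall 0 t) := hK.add (isCompact_closedBall 0 t)
  have h := (tendsto_measure_cthickening_of_isCompact (μ := μ) hcpt).comp
    (tendsto_one_div_add_atTop_nhds_zero_nat (𝕜 := ℝ))
  refine ((ENNReal.tendsto_toReal hcpt.measure_lt_top.ne).comp h).congr fun m => ?_
  have hm : (0 : ℝ) ≤ 1 / ((m : ℝ) + 1) := by positivity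
  simp only [Function.comp_apply, measureReal_def]
  rw [← hcpt.add_closedBall_zero hm, add_assoc, closedBall_add_closedBall ht hm, add_zero,
    add_comm t]

/-- The Steiner formula: the volume of the parallel bodies of a compact convex set is a
polynomial in the distance. -/
theorem exists_polynomial_measureReal_add_closedBall {K : Set E} (hK : IsCompact K)
    (hc : Convex ℝ K) (hne : K.Nonempty) :
    ∃ q : Polynomial ℝ, q.natDegree ≤ Module.finrank ℝ E ∧ ∀ t : ℝ, 0 ≤ t →
      μ.real (K + Metric.closedBall 0 t) = q.eval t := by
  choose r hr hrb using fun m : ℕ =>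
    exists_polynomial_between μ hK hc hne (Nat.one_div_pos_of_nat (α := ℝ) (n := m))
  have hlim : ∀ t : ℝ, 0 ≤ t → Filter.Tendsto (fun m => (r m).eval t) Filter.atTop
      (nhds (μ.real (K + Metric.closedBall 0 t))) := fun t ht =>
    tendsto_of_tendsto_of_tendsto_of_le_of_le tendsto_const_nhds
      (tendsto_measureReal_add_closedBall μ hK ht) (fun m => (hrb m t ht).1)
      (fun m => (hrb m t ht).2)
  -- Polynomials of degree at most d are determined by their values at 0, …, d, so convergence at
  -- these nodes forces the pointwise limit to be the interpolating polynomial.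
  set s := Finset.range (Module.finrank ℝ E + 1)
  set v : ℕ → ℝ := fun i => (i : ℝ)
  have hv : Set.InjOn v s := fun i _ j _ h => Nat.cast_injective h
  refine ⟨Lagrange.interpolate s v fun i => μ.real (K + Metric.closedBall 0 (v i)), ?_,
    fun t ht => ?_⟩
  · have := Lagrange.degree_interpolate_lt
      (fun i => μ.real (K + Metric.closedBall 0 (v i))) hv
    rw [Finset.card_range, Polynomial.degree_lt_iff_coeff_zero] at this
    exact Polynomial.natDegree_le_iff_coeff_eq_zero.2 this
  · refine tendsto_nhds_unique (hlim t ht) ?_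
    have hint : ∀ m, (r m).eval t =
        ∑ i ∈ s, (r m).eval (v i) * (Lagrange.basis s v i).eval t := by
      intro m
      conv_lhs => rw [Lagrange.eq_interpolate (f := r m) hv (by
        rw [Finset.card_range]
        exact (Polynomial.degree_le_of_natDegree_le (hr m)).trans_lt
          (Nat.cast_lt.2 (Nat.lt_succ_self _)))]
      simp [Lagrange.interpolate_apply, Polynomial.eval_finsetSum]
    simp only [hint, Lagrange.interpolate_apply, Polynomial.eval_finsetSum, Polynomial.eval_mul,
      Polynomial.eval_C]
    exact tendsto_finsetSum _ fun i _ => (hlim (v i) (Nat.cast_nonneg i)).mul_const _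

end Steiner

/-! ### A beta-type weight and its moments -/

section BetaWeight

theorem integral_pow_mul_one_sub_pow (a b : ℕ) :
    ∫ r in (0 : ℝ)..1, r ^ a * (1 - r) ^ b =
      (a.factorial * b.factorial : ℝ) / (a + b + 1).factorial := by
  induction b generalizing a with
  | zero =>
    simp only [pow_zero, mul_one, integral_pow, Nat.factorial_zero, Nat.cast_one, add_zero,
      Nat.factorial_succ, one_pow, zero_pow (Nat.succ_ne_zero a), sub_zero]
    have := Nat.factorial_ne_zero a
    push_cast
    field_simp
  | succ b ih =>
    -- Integration by parts: this function vanishes at both 0 and 1.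
    have hd : ∀ r : ℝ, HasDerivAt (fun r : ℝ => r ^ (a + 1) * (1 - r) ^ (b + 1))
        (((a : ℝ) + 1) * (r ^ a * (1 - r) ^ (b + 1)) -
          ((b : ℝ) + 1) * (r ^ (a + 1) * (1 - r) ^ b)) r := by
      intro r
      have h := (hasDerivAt_pow (a + 1) r).mul
        (((hasDerivAt_id r).const_sub 1).pow (b + 1))
      refine h.congr_deriv ?_
      simp only [Pi.pow_apply, id_eq, Nat.add_sub_cancel, Nat.cast_add, Nat.cast_one]
      ring
    have hc : ∀ c d : ℕ, Continuous fun r : ℝ => r ^ c * (1 - r) ^ d := fun c d => by fun_prop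
    have h := intervalIntegral.integral_eq_sub_of_hasDerivAt (a := 0) (b := 1)
      (fun r _ => hd r) (((hc _ _).const_mul _).sub ((hc _ _).const_mul _) |>.intervalIntegrable _ _)
    rw [intervalIntegral.integral_sub (((hc _ _).const_mul _).intervalIntegrable _ _)
      (((hc _ _).const_mul _).intervalIntegrable _ _), intervalIntegral.integral_const_mul,
      intervalIntegral.integral_const_mul, ih (a + 1)] at h
    simp only [sub_self, zero_pow (Nat.succ_ne_zero _), mul_zero, zero_mul, sub_zero] at h
    have ha : (a : ℝ) + 1 ≠ 0 := by positivity
    apply mul_left_cancel₀ ha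
    rw [sub_eq_zero.1 h, show a + 1 + b + 1 = a + (b + 1) + 1 by ring, Nat.factorial_succ a,
      Nat.factorial_succ b]
    push_cast
    ring

/-- The measure on `(0, 1]` with density `n (1 - r) ^ (n - 1)`. -/
noncomputable def betaWeight (n : ℕ) : Measure ℝ :=
  (volume.restrict (Set.Ioc 0 1)).withDensity fun r => ENNReal.ofReal (n * (1 - r) ^ (n - 1))

instance (n : ℕ) : SFinite (betaWeight n) := by
  unfold betaWeight
  infer_instance

theorem measurable_betaWeight_density (n : ℕ) :
    Measurable fun r : ℝ => ENNReal.ofReal (n * (1 - r) ^ (n - 1)) := by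
  fun_prop

theorem betaWeight_compl_Ioc (n : ℕ) : betaWeight n (Set.Ioc 0 1)ᶜ = 0 :=
  withDensity_absolutelyContinuous _ _ (by
    rw [Measure.restrict_apply measurableSet_Ioc.compl, Set.compl_inter_self, measure_empty])

theorem betaWeight_Ici_le {n : ℕ} (hn : n ≠ 0) {ρ : ℝ} (h1 : ρ ≤ 1) :
    betaWeight n (Set.Ici ρ) ≤ ENNReal.ofReal ((1 - ρ) ^ n) := by
  have hcont : Continuous fun r : ℝ => (n : ℝ) * (1 - r) ^ (n - 1) := by fun_prop
  have hd : ∀ r : ℝ, HasDerivAt (fun r : ℝ => -(1 - r) ^ n) ((n : ℝ) * (1 - r) ^ (n - 1)) r := by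
    intro r
    refine ((((hasDerivAt_id r).const_sub 1).pow n).neg).congr_deriv ?_
    simp
  have hint := intervalIntegral.integral_eq_sub_of_hasDerivAt (a := ρ) (b := 1)
      (fun r _ => hd r) (hcont.intervalIntegrable _ _)
  rw [sub_self, zero_pow hn, neg_zero, zero_sub, neg_neg] at hint
  rw [betaWeight, withDensity_apply _ measurableSet_Ici,
    Measure.restrict_restrict measurableSet_Ici, ← hint, intervalIntegral.integral_of_le h1,
    ofReal_integral_eq_lintegral_ofReal hcont.integrableOn_Ioc, Measure.restrict_congr_set Ioc_ae_eq_Icc]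
  · exact lintegral_mono_set fun r hr => ⟨hr.1, hr.2.2⟩
  · refine (ae_restrict_mem measurableSet_Ioc).mono fun r hr => ?_
    have : 0 ≤ 1 - r := sub_nonneg.2 hr.2
    simp only [Pi.zero_apply]
    positivity

theorem lintegral_pow_betaWeight {n : ℕ} (hn : n ≠ 0) :
    ∫⁻ r, ENNReal.ofReal (|r| ^ n) ∂betaWeight n =
      ENNReal.ofReal (((2 * n).choose n : ℝ)⁻¹) := by
  have hcont : Continuous fun r : ℝ => (n : ℝ) * (r ^ n * (1 - r) ^ (n - 1)) := by fun_prop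
  rw [betaWeight, lintegral_withDensity_eq_lintegral_mul _ (measurable_betaWeight_density n)
    (by fun_prop)]
  have hval : ∫ r in (0 : ℝ)..1, (n : ℝ) * (r ^ n * (1 - r) ^ (n - 1)) =
      ((2 * n).choose n : ℝ)⁻¹ := by
    rw [intervalIntegral.integral_const_mul, integral_pow_mul_one_sub_pow,
      Nat.cast_choose ℝ (show n ≤ 2 * n by omega)]
    obtain ⟨m, rfl⟩ := Nat.exists_eq_succ_of_ne_zero hn
    rw [Nat.succ_eq_add_one, Nat.add_sub_cancel, show m + 1 + m + 1 = 2 * (m + 1) by ring,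
      show 2 * (m + 1) - (m + 1) = m + 1 by omega, Nat.factorial_succ m]
    push_cast
    rw [inv_div]
    ring
  rw [← hval, intervalIntegral.integral_of_le zero_le_one,
    ofReal_integral_eq_lintegral_ofReal hcont.integrableOn_Ioc]
  · refine setLIntegral_congr_fun measurableSet_Ioc fun r hr => ?_
    have h1 : 0 ≤ 1 - r := sub_nonneg.2 hr.2
    simp only [Pi.mul_apply]
    rw [← ENNReal.ofReal_mul (by positivity), abs_of_pos hr.1]
    ring_nf
  · refine (ae_restrict_mem measurableSet_Ioc).mono fun r hr => ?_
    have h1 : 0 ≤ 1 - r := sub_nonneg.2 hr.2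
    have h0 := hr.1.le
    simp only [Pi.zero_apply]
    positivity

end BetaWeight

/-! ### The Rogers–Shephard inequality -/

section RogersShephard

variable {E : Type*} [NormedAddCommGroup E] [NormedSpace ℝ E] [FiniteDimensional ℝ E]
  [MeasurableSpace E] [BorelSpace E] (μ : Measure E) [μ.IsAddHaarMeasure]

theorem measurableSet_setOf_mem_and_sub_mem {L : Set E} (hL : IsCompact L) :
    MeasurableSet {z : E × E | z.2 ∈ L ∧ z.2 - z.1 ∈ L} :=
  ((hL.isClosed.preimage continuous_snd).inter
    (hL.isClosed.preimage (continuous_snd.sub continuous_fst))).measurableSet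

/-- Tonelli: for fixed y in L, the admissible x form y - L, of measure μ L. -/
theorem lintegral_measure_inter_translate {L : Set E} (hL : IsCompact L) :
    ∫⁻ x, μ {y | y ∈ L ∧ y - x ∈ L} ∂μ = μ L * μ L := by
  have hA := measurableSet_setOf_mem_and_sub_mem hL
  have h1 := Measure.prod_apply (μ := μ) (ν := μ) hA
  rw [Measure.prod_apply_symm hA] at h1
  refine h1.symm.trans ?_
  have h2 : ∀ y, μ ((fun x => (x, y)) ⁻¹' {z : E × E | z.2 ∈ L ∧ z.2 - z.1 ∈ L}) =
      L.indicator (fun _ => μ L) y := by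
    intro y
    by_cases hy : y ∈ L
    · rw [Set.indicator_of_mem hy,
        ← (Measure.measurePreserving_sub_left μ y).measure_preimage hL.measurableSet.nullMeasurableSet]
      simp [hy, Set.preimage]
    · simp [hy]
  simp only [h2]
  rw [lintegral_indicator hL.measurableSet, setLIntegral_const]

/-- If x = r(a - b), the copy ra + (1 - r)L lies in both L and x + L by convexity. -/
theorem le_measure_inter_translate {L : Set E} (hc : Convex ℝ L) {r : ℝ} (hr0 : 0 ≤ r)
    (hr1 : r ≤ 1) {x : E} (hx : x ∈ r • (L - L)) :
    ENNReal.ofReal ((1 - r) ^ Module.finrank ℝ E) * μ L ≤ μ {y | y ∈ L ∧ y - x ∈ L} := by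
  obtain ⟨_, ⟨a, ha, b, hb, rfl⟩, rfl⟩ := hx
  have h1r : 0 ≤ 1 - r := sub_nonneg.2 hr1
  have h : (r • a) +ᵥ ((1 - r) • L) ⊆ {y | y ∈ L ∧ y - r • (a - b) ∈ L} := by
    rintro _ ⟨_, ⟨l, hl, rfl⟩, rfl⟩
    simp only [vadd_eq_add, Set.mem_ofPred_eq]
    refine ⟨hc ha hl hr0 h1r (by ring), ?_⟩
    have : r • a + (1 - r) • l - r • (a - b) = r • b + (1 - r) • l := by module
    rw [this]
    exact hc hb hl hr0 h1r (by ring)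
  refine le_trans (le_of_eq ?_) (measure_mono h)
  rw [measure_vadd, Measure.addHaar_smul, abs_of_nonneg (by positivity)]

/-- Let φ be the ratio of the right side to μ L. Each r in (0, 1] with x ∈ r(L - L) satisfies (1 -
r)^n ≤ φ, that is r ≥ 1 - φ^(1/n), and the weight of that tail is at most φ. -/
theorem betaWeight_mul_le_measure_inter_translate {L : Set E} (hL : IsCompact L)
    (hc : Convex ℝ L) (hn : Module.finrank ℝ E ≠ 0) (h0 : μ L ≠ 0) (x : E) :
    betaWeight (Module.finrank ℝ E) {r | r⁻¹ • x ∈ L - L} * μ L ≤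
      μ {y | y ∈ L ∧ y - x ∈ L} := by
  set n := Module.finrank ℝ E
  set m := μ {y | y ∈ L ∧ y - x ∈ L}
  have htop : μ L ≠ ⊤ := hL.measure_lt_top.ne
  have hmL : m ≤ μ L := measure_mono fun y hy => hy.1
  have hmtop : m ≠ ⊤ := ne_top_of_le_ne_top htop hmL
  have hLpos : 0 < (μ L).toReal := ENNReal.toReal_pos h0 htop
  set φ : ℝ := m.toReal / (μ L).toReal
  have hφ0 : 0 ≤ φ := by positivity
  have hφ1 : φ ≤ 1 := div_le_one_of_le₀ (ENNReal.toReal_mono htop hmL) hLpos.le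
  set σ : ℝ := φ ^ ((n : ℝ)⁻¹)
  have hσ0 : 0 ≤ σ := Real.rpow_nonneg hφ0 _
  have hσ1 : σ ≤ 1 := Real.rpow_le_one hφ0 hφ1 (by positivity)
  have hσn : σ ^ n = φ := Real.rpow_inv_natCast_pow hφ0 hn
  have hsub : {r : ℝ | r⁻¹ • x ∈ L - L} ⊆ Set.Ici (1 - σ) ∪ (Set.Ioc 0 1)ᶜ := by
    intro r hr
    by_cases hr' : r ∈ Set.Ioc (0 : ℝ) 1
    · left
      have hx : x ∈ r • (L - L) := ⟨r⁻¹ • x, hr, smul_inv_smul₀ hr'.1.ne' x⟩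
      have h := le_measure_inter_translate μ hc hr'.1.le hr'.2 hx
      have h1r : 0 ≤ 1 - r := sub_nonneg.2 hr'.2
      have h' := ENNReal.toReal_mono hmtop h
      rw [ENNReal.toReal_mul, ENNReal.toReal_ofReal (by positivity)] at h'
      have h'' : (1 - r) ^ n ≤ σ ^ n := by
        rw [hσn]
        exact (le_div_iff₀ hLpos).2 h'
      have := (pow_le_pow_iff_left₀ h1r hσ0 hn).1 h''
      simp only [Set.mem_Ici]
      linarith
    · exact Or.inr hr'
  have hw : betaWeight n {r | r⁻¹ • x ∈ L - L} ≤ ENNReal.ofReal φ := by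
    refine (measure_mono hsub).trans ((measure_union_le _ _).trans ?_)
    rw [betaWeight_compl_Ioc, add_zero]
    refine (betaWeight_Ici_le hn (by linarith)).trans ?_
    rw [sub_sub_cancel, hσn]
  calc _ ≤ ENNReal.ofReal φ * μ L := by gcongr
    _ = ENNReal.ofReal φ * ENNReal.ofReal (μ L).toReal := by rw [ENNReal.ofReal_toReal htop]
    _ = m := by
      rw [← ENNReal.ofReal_mul hφ0, div_mul_cancel₀ _ hLpos.ne', ENNReal.ofReal_toReal hmtop]

/-- Tonelli in the other order: the slice at r is r(L - L), of measure r^n μ(L - L). -/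
theorem lintegral_betaWeight_sub {L : Set E} (hL : IsCompact L)
    (hn : Module.finrank ℝ E ≠ 0) :
    ∫⁻ x, betaWeight (Module.finrank ℝ E) {r | r⁻¹ • x ∈ L - L} ∂μ =
      ENNReal.ofReal (((2 * Module.finrank ℝ E).choose (Module.finrank ℝ E) : ℝ)⁻¹) *
        μ (L - L) := by
  set n := Module.finrank ℝ E
  have hB : MeasurableSet {z : E × ℝ | z.2⁻¹ • z.1 ∈ L - L} := by
    have hm : Measurable fun z : E × ℝ => z.2⁻¹ • z.1 := by fun_prop
    exact hm (sub_eq_add_neg L L ▸ hL.add hL.neg).measurableSet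
  have h1 := Measure.prod_apply (μ := μ) (ν := betaWeight n) hB
  rw [Measure.prod_apply_symm hB] at h1
  refine h1.symm.trans ?_
  have hae : ∀ᵐ r ∂betaWeight n,
      μ ((fun x => (x, r)) ⁻¹' {z : E × ℝ | z.2⁻¹ • z.1 ∈ L - L}) =
        ENNReal.ofReal (|r| ^ n) * μ (L - L) := by
    filter_upwards [measure_eq_zero_iff_ae_notMem.1 (betaWeight_compl_Ioc n)] with r hr
    have hr0 : r ≠ 0 := (Set.notMem_compl_iff.1 hr).1.ne'
    have := Measure.addHaar_preimage_smul μ (inv_ne_zero hr0) (L - L)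
    rw [inv_pow, inv_inv, abs_pow] at this
    exact this
  rw [lintegral_congr_ae hae, lintegral_mul_const _ (by fun_prop), lintegral_pow_betaWeight hn]

/-- The Rogers–Shephard inequality for the difference body. -/
theorem measureReal_sub_self_le {L : Set E} (hL : IsCompact L) (hc : Convex ℝ L)
    (h0 : μ L ≠ 0) :
    μ.real (L - L) ≤
      ((2 * Module.finrank ℝ E).choose (Module.finrank ℝ E) : ℝ) * μ.real L := by
  -- In dimension 0 the weight is the zero measure, so this case is separate.
  rcases eq_or_ne (Module.finrank ℝ E) 0 with hn | hn
  · have : Subsingleton E := Module.finrank_zero_iff.1 hn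
    obtain ⟨a, ha⟩ := nonempty_of_measure_ne_zero h0
    rw [hn, mul_zero, Nat.choose_self, Nat.cast_one, one_mul]
    refine measureReal_mono (fun x _ => ?_) hL.measure_lt_top.ne
    rwa [Subsingleton.elim x a]
  set n := Module.finrank ℝ E
  have htop : μ L ≠ ⊤ := hL.measure_lt_top.ne
  have hpos : (0 : ℝ) < (2 * n).choose n := by
    exact_mod_cast Nat.choose_pos (by omega)
  have h1 : (∫⁻ x, betaWeight n {r | r⁻¹ • x ∈ L - L} ∂μ) * μ L ≤ μ L * μ L := by
    rw [← lintegral_mul_const' _ _ htop, ← lintegral_measure_inter_translate μ hL]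
    exact lintegral_mono fun x => betaWeight_mul_le_measure_inter_translate μ hL hc hn h0 x
  have h2 := (ENNReal.mul_le_mul_iff_left h0 htop).1 h1
  rw [lintegral_betaWeight_sub μ hL hn] at h2
  have h3 := ENNReal.toReal_mono htop h2
  rw [ENNReal.toReal_mul, ENNReal.toReal_ofReal (by positivity)] at h3
  exact (inv_mul_le_iff₀ hpos).1 h3

end RogersShephard

/-! ### Integral representation of the Wills functional and parallel volumes -/

section Wills

theorem unitBallVolume_eq (k : ℕ) :
    unitBallVolume k = Real.pi ^ ((k : ℝ) / 2) / Real.Gamma ((k : ℝ) / 2 + 1) := by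
  have hΓ : 0 < Real.Gamma ((k : ℝ) / 2 + 1) := Real.Gamma_pos_of_pos (by positivity)
  rcases Nat.eq_zero_or_pos k with rfl | hk
  · have h : Metric.closedBall (0 : EuclideanSpace ℝ (Fin 0)) 1 = Set.univ :=
      Set.eq_univ_of_forall fun x => by simp [Subsingleton.elim x 0]
    have hv : volume (Set.univ : Set (EuclideanSpace ℝ (Fin 0))) = 1 := by
      rw [volume_euclideanSpace_eq_dirac, measure_univ]
    simp [unitBallVolume, h, measureReal_def, hv]
  · have : Nonempty (Fin k) := ⟨⟨0, hk⟩⟩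
    rw [unitBallVolume, measureReal_def, EuclideanSpace.volume_closedBall, Fintype.card_fin,
      ENNReal.ofReal_one, one_pow, one_mul, ENNReal.toReal_ofReal (by positivity),
      Real.sqrt_eq_rpow, ← Real.rpow_natCast, ← Real.rpow_mul Real.pi_pos.le]
    ring_nf

/-- The density whose integral against the volumes of parallel bodies is the Wills functional. -/
noncomputable def willsWeight (t : ℝ) : ℝ := 2 * Real.pi * t * Real.exp (-Real.pi * t ^ 2)

theorem willsWeight_mul_pow (j : ℕ) {t : ℝ} (ht : 0 < t) :
    willsWeight t * t ^ j =
      2 * Real.pi * (t ^ ((j : ℝ) + 1) * Real.exp (-Real.pi * t ^ (2 : ℝ))) := by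
  rw [willsWeight, Real.rpow_add ht, Real.rpow_one, Real.rpow_natCast, Real.rpow_two]
  ring

theorem integrableOn_willsWeight_mul_pow (j : ℕ) :
    IntegrableOn (fun t => willsWeight t * t ^ j) (Set.Ioi 0) := by
  have h := integrableOn_rpow_mul_exp_neg_mul_rpow (s := (j : ℝ) + 1) (p := 2) (b := Real.pi)
    (by linarith [(Nat.cast_nonneg j : (0 : ℝ) ≤ j)]) two_pos Real.pi_pos
  exact IntegrableOn.congr_fun (h.const_mul (2 * Real.pi)) (fun t ht => (willsWeight_mul_pow j ht).symm)
    measurableSet_Ioi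

theorem integral_willsWeight_mul_pow (j : ℕ) :
    ∫ t in Set.Ioi 0, willsWeight t * t ^ j = (unitBallVolume j)⁻¹ := by
  rw [setIntegral_congr_fun measurableSet_Ioi fun t ht => willsWeight_mul_pow j ht,
    integral_const_mul, integral_rpow_mul_exp_neg_mul_rpow two_pos
      (by linarith [(Nat.cast_nonneg j : (0 : ℝ) ≤ j)]) Real.pi_pos, unitBallVolume_eq, inv_div,
    show ((j : ℝ) + 1 + 1) / 2 = (j : ℝ) / 2 + 1 by ring,
    show -((j : ℝ) + 1 + 1) / 2 = -((j : ℝ) / 2) - 1 by ring, Real.rpow_sub Real.pi_pos,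
    Real.rpow_one, Real.rpow_neg Real.pi_pos.le]
  have := Real.pi_ne_zero
  field_simp

variable {n : ℕ}

/-- The volume of the parallel body of `K` at distance `t`. -/
noncomputable def parallelVolume (K : ConvexBody (EuclideanSpace ℝ (Fin n))) (t : ℝ) : ℝ :=
  volume.real ((K : Set (EuclideanSpace ℝ (Fin n))) +
    t • Metric.closedBall (0 : EuclideanSpace ℝ (Fin n)) 1)

theorem exists_isSteinerCoeff (K : ConvexBody (EuclideanSpace ℝ (Fin n))) :
    ∃ W, IsSteinerCoeff K W := by
  obtain ⟨q, hq, hqe⟩ := exists_polynomial_measureReal_add_closedBall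
    (volume : Measure (EuclideanSpace ℝ (Fin n))) K.isCompact K.convex K.nonempty
  rw [finrank_euclideanSpace_fin] at hq
  refine ⟨fun i => q.coeff i / n.choose i, fun t ht => ?_⟩
  rw [smul_unitClosedBall_of_nonneg ht, hqe t ht,
    Polynomial.eval_eq_sum_range' (Nat.lt_succ_iff.2 hq), ← Fin.sum_univ_eq_sum_range
      (fun i => q.coeff i * t ^ i)]
  refine Finset.sum_congr rfl fun i _ => ?_
  have hne : (n.choose i : ℝ) ≠ 0 := by
    exact_mod_cast (Nat.choose_pos (Nat.lt_succ_iff.mp i.isLt)).ne'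
  rw [mul_div_cancel₀ _ hne]

/-- Rules out the default value 0 in `quermassintegral`. -/
theorem isSteinerCoeff_quermassintegral (K : ConvexBody (EuclideanSpace ℝ (Fin n))) :
    IsSteinerCoeff K (quermassintegral K) := by
  obtain ⟨W, hW⟩ := exists_isSteinerCoeff K
  rwa [hW.quermassintegral_eq]

theorem willsWeight_mul_parallelVolume (K : ConvexBody (EuclideanSpace ℝ (Fin n))) {t : ℝ}
    (ht : 0 ≤ t) :
    willsWeight t * parallelVolume K t =
      ∑ i : Fin (n + 1), (n.choose i : ℝ) * quermassintegral K i *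
        (willsWeight t * t ^ (i : ℕ)) := by
  rw [parallelVolume, isSteinerCoeff_quermassintegral K t ht, Finset.mul_sum]
  exact Finset.sum_congr rfl fun i _ => by ring

theorem integrableOn_willsWeight_mul_parallelVolume
    (K : ConvexBody (EuclideanSpace ℝ (Fin n))) :
    IntegrableOn (fun t => willsWeight t * parallelVolume K t) (Set.Ioi 0) :=
  IntegrableOn.congr_fun (integrable_finsetSum _ fun (i : Fin (n + 1)) _ =>
    (integrableOn_willsWeight_mul_pow i).const_mul _)
      (fun _ ht => (willsWeight_mul_parallelVolume K (le_of_lt ht)).symm) measurableSet_Ioi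

/-- Hadwiger's integral representation of the Wills functional. -/
theorem willsFunctional_eq_integral (K : ConvexBody (EuclideanSpace ℝ (Fin n))) :
    willsFunctional K = ∫ t in Set.Ioi 0, willsWeight t * parallelVolume K t := by
  rw [setIntegral_congr_fun measurableSet_Ioi fun t ht =>
    willsWeight_mul_parallelVolume K (le_of_lt ht), integral_finsetSum _
    fun (i : Fin (n + 1)) _ => (integrableOn_willsWeight_mul_pow i).const_mul _]
  simp only [integral_const_mul, integral_willsWeight_mul_pow]
  -- Reversing the index pairs W_i with V_{n-i}, whose normalization is κ_i.
  rw [willsFunctional, ← Equiv.sum_comp Fin.revPerm]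
  refine Finset.sum_congr rfl fun i _ => ?_
  have hi : (i : ℕ) ≤ n := Nat.lt_succ_iff.1 i.isLt
  rw [intrinsicVolume, Fin.revPerm_apply, Fin.rev_rev, Fin.val_rev,
    show n + 1 - ((i : ℕ) + 1) = n - i by omega, Nat.sub_sub_self hi, Nat.choose_symm hi]
  ring

theorem parallelVolume_mono (K : ConvexBody (EuclideanSpace ℝ (Fin n))) {s t : ℝ} (hs : 0 ≤ s)
    (hst : s ≤ t) : parallelVolume K s ≤ parallelVolume K t := by
  rw [parallelVolume, parallelVolume, smul_unitClosedBall_of_nonneg hs,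
    smul_unitClosedBall_of_nonneg (hs.trans hst)]
  exact measureReal_mono (Set.add_subset_add_left (Metric.closedBall_subset_closedBall hst))
    (K.isCompact.add (isCompact_closedBall 0 t)).measure_lt_top.ne

theorem parallelVolume_smul (K : ConvexBody (EuclideanSpace ℝ (Fin n))) {c : ℝ} (hc : 0 ≤ c)
    (t : ℝ) : parallelVolume (c • K) (c * t) = c ^ n * parallelVolume K t := by
  rw [parallelVolume, parallelVolume, ConvexBody.coe_smul, mul_smul, ← smul_add, measureReal_def,
    Measure.addHaar_smul, ENNReal.toReal_mul, ENNReal.toReal_ofReal (abs_nonneg _),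
    finrank_euclideanSpace_fin, abs_of_nonneg (by positivity), measureReal_def]

theorem parallelVolume_differenceBody_le (K : ConvexBody (EuclideanSpace ℝ (Fin n))) {t : ℝ}
    (ht : 0 < t) :
    parallelVolume (differenceBody K) t ≤
      ((2 * n).choose n : ℝ) * parallelVolume K (t / 2) := by
  have ht2 : 0 < t / 2 := by positivity
  rw [parallelVolume, parallelVolume, smul_unitClosedBall_of_nonneg ht.le,
    smul_unitClosedBall_of_nonneg ht2.le]
  set B := Metric.closedBall (0 : EuclideanSpace ℝ (Fin n)) (t / 2)
  have hset : (differenceBody K : Set (EuclideanSpace ℝ (Fin n))) + Metric.closedBall 0 t =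
      ((K : Set (EuclideanSpace ℝ (Fin n))) + B) - ((K : Set (EuclideanSpace ℝ (Fin n))) + B) := by
    have hB : Metric.closedBall (0 : EuclideanSpace ℝ (Fin n)) t = B + -B := by
      rw [neg_closedBall, neg_zero, closedBall_add_closedBall ht2.le ht2.le, add_zero,
        add_halves]
    have hneg : (-1 : ℝ) • (K : Set (EuclideanSpace ℝ (Fin n))) = -K := by
      ext x
      simp
    rw [differenceBody, ConvexBody.coe_add, ConvexBody.coe_smul, hneg, hB,
      sub_eq_add_neg, neg_add, add_add_add_comm]
  -- Adding a ball of positive radius gives positive volume even when K is flat.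
  have hpos : volume ((K : Set (EuclideanSpace ℝ (Fin n))) + B) ≠ 0 := by
    obtain ⟨a, ha⟩ := K.nonempty
    refine ((Metric.measure_closedBall_pos volume a ht2).trans_le (measure_mono ?_)).ne'
    intro x hx
    refine ⟨a, ha, x - a, ?_, add_sub_cancel _ _⟩
    rw [mem_closedBall_zero_iff, ← dist_eq_norm]
    exact hx
  have h := measureReal_sub_self_le volume (K.isCompact.add (isCompact_closedBall 0 (t / 2)))
    (K.convex.add (convex_closedBall 0 (t / 2))) hpos
  rw [finrank_euclideanSpace_fin] at h
  rw [hset]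
  exact h

end Wills

/-! ### Pointwise comparison under the integral -/

theorem mainTheorem10 (n : ℕ) (K : ConvexBody (EuclideanSpace ℝ (Fin n))) :
    willsFunctional (differenceBody K) ≤
      ((2 * n).choose n : ℝ) / (2 : ℝ) ^ ((n : ℝ) / 2) * willsFunctional (Real.sqrt 2 • K) := by
  rw [willsFunctional_eq_integral, willsFunctional_eq_integral, ← integral_const_mul]
  refine setIntegral_mono_on (integrableOn_willsWeight_mul_parallelVolume _)
    ((integrableOn_willsWeight_mul_parallelVolume _).const_mul _) measurableSet_Ioi fun t ht => ?_
  have ht : 0 < t := ht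
  have hw : 0 ≤ willsWeight t := by
    unfold willsWeight
    positivity
  have h2 : (0 : ℝ) < Real.sqrt 2 := by positivity
  have hle : t / 2 ≤ t / Real.sqrt 2 :=
    div_le_div_of_nonneg_left ht.le h2 (Real.sqrt_le_iff.2 ⟨by norm_num, by norm_num⟩)
  have hpow : (2 : ℝ) ^ ((n : ℝ) / 2) = Real.sqrt 2 ^ n := by
    rw [Real.sqrt_eq_rpow, ← Real.rpow_natCast, ← Real.rpow_mul zero_le_two]
    ring_nf
  have hscale : parallelVolume (Real.sqrt 2 • K) t =
      Real.sqrt 2 ^ n * parallelVolume K (t / Real.sqrt 2) := by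
    rw [← parallelVolume_smul K h2.le, mul_div_cancel₀ _ h2.ne']
  calc willsWeight t * parallelVolume (differenceBody K) t
      ≤ willsWeight t * (((2 * n).choose n : ℝ) * parallelVolume K (t / Real.sqrt 2)) := by
        refine mul_le_mul_of_nonneg_left ((parallelVolume_differenceBody_le K ht).trans ?_) hw
        exact mul_le_mul_of_nonneg_left (parallelVolume_mono K (by positivity) hle)
          (Nat.cast_nonneg _)
    _ = _ := by
        rw [hpow, hscale]
        have := h2.ne'
        field_simp
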